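/- Let $d\ge 3$, $\mathbb I=[0,1]$, and let $\lambda$ denote Lebesgue measure. For a $d$-dimensional copula $C$ let $\mu_C$ be the probability measure on $\mathbb I^d$ with $\mu_C([\mathbf 0,\mathbf x])=C(\mathbf x)$ for all $\mathbf x\in\mathbb I^d$, let $C^{1:d-1}(\mathbf x)=C(\mathbf x,1)$ be the marginal copula of the first $d-1$ coordinates, let $K_C(\mathbf x,\cdot)$, $\mathbf x\in\mathbb I^{d-1}$, be (a version of) the regular conditional distribution, under $\mu_C$, of the last coordinate given that the first $d-1$ coordinates equal $\mathbf x$, let $L_t=\{\mathbf z\in\mathbb I^d : C(\mathbf z)=t\}$ for $t\in\mathbb I$, and let $F_K^d(t)=\mu_C(\{\mathbf z\in\mathbb I^d : C(\mathbf z)\le t\})$ be the Kendall distribution function of $C$. A generator is a continuous, non-increasing function $\psi:[0,\infty)\to[0,1]$ with $\psi(0)=1$, $\lim_{z\to\infty}\psi(z)=0=:\psi(\infty)$, $\psi(1)=\tfrac12$, that is strictly decreasing on $[0,\inf\{z\in[0,\infty]:\psi(z)=0\}]$; its pseudo-inverse is $\varphi(y)=\inf\{z\in[0,\infty]:\psi(z)=y\}$,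 $y\in\mathbb I$. A $d$-dimensional copula $C$ is Archimedean if $C(\mathbf x)=\psi(\varphi(x_1)+\dots+\varphi(x_d))$ for all $\mathbf x\in\mathbb I^d$, for some generator $\psi$. A finite measure is called singular continuous if it is singular with respect to Lebesgue measure and has no point masses. The copula $C$ is called singular continuous if $\mu_C$ is singular continuous and, moreover, $K_C(\mathbf x,\cdot)$ is singular continuous for $\mu_{C^{1:d-1}}$-almost every $\mathbf x\in\mathbb I^{d-1}$. A function $F$ on $\mathbb I$ is called singular if $F'(y)$ exists and equals $0$ for $\lambda$-almost every $y\in\mathbb I$. **Theorem.** For every $d\ge 3$ there exists a $d$-dimensional Archimedean copula $C$ with the following properties. 1. $C$ is singular continuous and has full support, i.e. the support of $\mu_C$ is $\mathbb I^d$. 2. For $\mu_{C^{1:d-1}}$-almost every $\mathbf x\in\mathbb I^{d-1}$ the conditional distribution function $y\mapsto K_C(\mathbf x,[0,y])$ is continuous, strictly increasing and singular on $\mathbb I$. 3. $\mu_C(L_t)=0$ for every $t\in\mathbb I$. 4. The Kendall distribution function $F_K^d$ is continuous, strictly increasing and singular on $\mathbb I$. -/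

import Mathlib

open MeasureTheory ProbabilityTheory Set Filter Topology
open scoped unitInterval ENNReal NNReal

noncomputable section

namespace ArchCopula

/-- Two finite measures on `[0,1]^d` with the same values on the boxes `[0,x]` agree. -/
theorem measure_ext_Iic {d : ℕ} {μ ν : Measure (Fin d → I)} [IsFiniteMeasure μ]
    (h : ∀ x, μ (Iic x) = ν (Iic x)) : μ = ν := by
  have hgen : (inferInstance : MeasurableSpace (Fin d → I)) =
      MeasurableSpace.generateFrom (pi univ '' pi univ fun _ : Fin d => range (Iic : I → Set I)) := by
    have hI : (inferInstance : MeasurableSpace I) =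
        MeasurableSpace.generateFrom (range (Iic : I → Set I)) := by
      rw [← borel_eq_generateFrom_Iic]
      exact BorelSpace.measurable_eq
    have hspan : IsCountablySpanning (range (Iic : I → Set I)) :=
      ⟨fun _ => Iic 1, fun _ => ⟨1, rfl⟩, by ext x; simp [unitInterval.le_one']⟩
    exact (generateFrom_eq_pi (fun _ : Fin d => hI.symm) fun _ => hspan).symm
  have hbox : ∀ s ∈ (pi univ '' pi univ fun _ : Fin d => range (Iic : I → Set I)),
      ∃ x : Fin d → I, s = Iic x := by
    rintro _ ⟨f, hf, rfl⟩
    choose x hx using fun i => hf i (mem_univ i)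
    refine ⟨x, ?_⟩
    rw [← pi_univ_Iic]
    exact pi_congr rfl fun i _ => (hx i).symm
  refine ext_of_generate_finite _ hgen ?_ ?_ ?_
  · refine IsPiSystem.pi fun _ => ?_
    rintro _ ⟨a, rfl⟩ _ ⟨b, rfl⟩ _
    exact ⟨a ⊓ b, Iic_inter_Iic.symm⟩
  · intro s hs
    obtain ⟨x, rfl⟩ := hbox s hs
    exact h x
  · have h1 : (Iic (fun _ => 1) : Set (Fin d → I)) = univ := by
      ext x; simp [Pi.le_def, unitInterval.le_one']
    simpa [h1] using h fun _ => 1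

/-- A `d`-dimensional copula: (the restriction to `[0,1]^d` of) a distribution function of a
probability measure on `[0,1]^d` all of whose univariate marginals are uniform on `[0,1]`. -/
structure Copula (d : ℕ) where
  toFun : (Fin d → I) → I
  exists_measure : ∃ μ : Measure (Fin d → I), IsProbabilityMeasure μ ∧
    (∀ i, μ.map (fun x => x i) = volume) ∧
    ∀ x, μ (Iic x) = ENNReal.ofReal (toFun x)

instance {d : ℕ} : CoeFun (Copula d) (fun _ => (Fin d → I) → I) := ⟨Copula.toFun⟩

namespace Copula

variable {d n : ℕ}

/-- The `d`-stochastic measure `μ_C` of the copula `C`: the probability measure with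
`μ_C [0,x] = C x` (unique by `Copula.eq_measure`). -/
def measure (C : Copula d) : Measure (Fin d → I) := C.exists_measure.choose

instance (C : Copula d) : IsProbabilityMeasure C.measure := C.exists_measure.choose_spec.1

theorem map_measure (C : Copula d) (i : Fin d) : C.measure.map (fun x => x i) = volume :=
  C.exists_measure.choose_spec.2.1 i

theorem measure_Iic (C : Copula d) (x : Fin d → I) :
    C.measure (Iic x) = ENNReal.ofReal (C x) :=
  C.exists_measure.choose_spec.2.2 x

theorem eq_measure (C : Copula d) {μ : Measure (Fin d → I)}
    (h : ∀ x, μ (Iic x) = ENNReal.ofReal (C x)) : μ = C.measure :=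
  (measure_ext_Iic fun x => (C.measure_Iic x).trans (h x).symm).symm

theorem measurable_init : Measurable (Fin.init : (Fin (n + 1) → I) → (Fin n → I)) :=
  measurable_pi_lambda _ fun i => measurable_pi_apply i.castSucc

theorem map_init_Iic (C : Copula (n + 1)) (x : Fin n → I) :
    C.measure.map Fin.init (Iic x) = ENNReal.ofReal (C (Fin.snoc x 1)) := by
  rw [Measure.map_apply measurable_init measurableSet_Iic, ← C.measure_Iic]
  congr 1
  ext z
  simp only [mem_preimage, mem_Iic, Pi.le_def]
  constructor
  · intro h i
    refine Fin.lastCases ?_ (fun j => ?_) i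
    · simpa using unitInterval.le_one'
    · simpa [Fin.init] using h j
  · intro h j
    simpa [Fin.init] using h j.castSucc

/-- The marginal copula `C^{1:d-1}` of the first `d - 1 = n` coordinates,
`C^{1:d-1} x = C (x, 1)`. -/
def initMarginal (C : Copula (n + 1)) : Copula n where
  toFun x := C (Fin.snoc x 1)
  exists_measure := by
    refine ⟨C.measure.map Fin.init,
      Measure.isProbabilityMeasure_map measurable_init.aemeasurable, fun i => ?_,
      C.map_init_Iic⟩
    rw [Measure.map_map (measurable_pi_apply i) measurable_init]
    exact C.map_measure i.castSucc

/-- The measure of the marginal copula is the marginal of the measure. -/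
theorem measure_initMarginal (C : Copula (n + 1)) :
    C.initMarginal.measure = C.measure.map Fin.init :=
  (C.initMarginal.eq_measure C.map_init_Iic).symm

/-- The `(d-1)`-Markov kernel `K_C` of `C`: (a version of) the regular conditional distribution
of the last coordinate given the first `d - 1 = n` coordinates, under `μ_C`. -/
def markovKernel (C : Copula (n + 1)) : Kernel (Fin n → I) I :=
  condDistrib (fun x : Fin (n + 1) → I => x (Fin.last n)) Fin.init C.measure

/-- The conditional distribution function `y ↦ K_C(x, [0,y])`, as a function of a real `y`. -/
def condCDF (C : Copula (n + 1)) (x : Fin n → I) (y : ℝ) : ℝ :=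
  (C.markovKernel x).real {z : I | (z : ℝ) ≤ y}

/-- The `t`-level set `L_t` of `C`. -/
def levelSet (C : Copula d) (t : I) : Set (Fin d → I) := {x | C x = t}

/-- The Kendall distribution function `F_K t = μ_C {x | C x ≤ t}`, as a function of a real `t`. -/
def kendallCDF (C : Copula d) (t : ℝ) : ℝ :=
  C.measure.real {x | (C x : ℝ) ≤ t}

end Copula

/-- The extension of `ψ : [0,∞) → [0,1]` to `[0,∞]` by `ψ(∞) = 0`. -/
def extendTop (ψ : ℝ≥0 → I) (z : ℝ≥0∞) : I := if z = ∞ then 0 else ψ z.toNNReal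

/-- Archimedean generators, normalized by `ψ(1) = 1/2`. -/
structure IsGenerator (ψ : ℝ≥0 → I) : Prop where
  continuous : Continuous ψ
  antitone : Antitone ψ
  map_zero : ψ 0 = 1
  tendsto : Tendsto ψ atTop (𝓝 0)
  strictAntiOn : StrictAntiOn (extendTop ψ) (Iic (sInf {z | extendTop ψ z = 0}))
  normalized : (ψ 1 : ℝ) = 1 / 2

/-- The pseudo-inverse `φ(y) = inf {z ∈ [0,∞] | ψ(z) = y}` of a generator. -/
def pseudoInverse (ψ : ℝ≥0 → I) (y : I) : ℝ≥0∞ := sInf {z | extendTop ψ z = y}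

/-- `C` is Archimedean: `C(x) = ψ(φ(x_1) + ⋯ + φ(x_d))` for some generator `ψ`. -/
def Copula.IsArchimedean {d : ℕ} (C : Copula d) : Prop :=
  ∃ ψ : ℝ≥0 → I, IsGenerator ψ ∧ ∀ x, C x = extendTop ψ (∑ i, pseudoInverse ψ (x i))

/-- A measure is singular continuous if it is singular with respect to Lebesgue measure and has no
point masses. -/
def IsSingularContinuous {X : Type*} [MeasureSpace X] (μ : Measure X) : Prop :=
  μ ⟂ₘ volume ∧ ∀ x, μ {x} = 0

/-- A copula is singular continuous if `μ_C` is a singular continuous measure which, moreover,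
coincides with its singular (continuous) component in the disintegration with respect to the first
`d - 1` coordinates, i.e., almost all the conditional measures `K_C(x, ·)` are singular
continuous. -/
def Copula.SingularContinuous {n : ℕ} (C : Copula (n + 1)) : Prop :=
  IsSingularContinuous C.measure ∧
    ∀ᵐ x ∂C.initMarginal.measure, IsSingularContinuous (C.markovKernel x)

/-- A function on `[0,1]` is singular if its derivative exists and is zero Lebesgue-almost
everywhere on `[0,1]`. -/
def IsSingularFun (F : ℝ → ℝ) : Prop :=
  ∀ᵐ y ∂(volume.restrict (Icc (0 : ℝ) 1)), HasDerivAt F 0 y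

end ArchCopula

end

open scoped Pointwise

namespace ArchCopula

/-! ### Distribution functions of singular measures -/

/-! Put d = n + 1 and let `κ` be a finite, non-atomic, singular measure on the line with full
support and finite n-th moment of the positive part. Restrict Lebesgue ⊗ `κ` to the pairs (x, r)
with x ≥ 0 and ∑ x_i ≤ r, and set X_i = x_i for i ≤ n and X_{n+1} = r - ∑ x_i. Given r, the point X
is uniform on the simplex of size r. Since solid simplices have volume c t^n, P(X ≥ a) = c ∫ (r - ∑
a_i)_+^n dκ = ψ(∑ a_i), where ψ is a Williamson transform of `κ`. Rescaling `κ` gives ψ(0) = 1 and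
ψ(1) = 1/2, so U_i = ψ(X_i) is distributed according to the Archimedean copula C with generator ψ.

Every property of C is then inherited from `κ`. Given x, the sum r has law `κ` conditioned on [∑
x_i, ∞), so K_C is the image under ψ of a conditioned and translated copy of `κ`. Moreover C(U) =
ψ(r), and the law of r is absolutely continuous with respect to `κ`. As ψ is Lipschitz and strictly
decreasing, it maps null sets to null sets and creates no atoms, so these laws are again singular,
non-atomic and of full support; their distribution functions are continuous, strictly increasing and
singular. Singularity of μ_C follows from that of its kernels.

The carrying lemmas are `exists_isRadial` (choice of `κ`), `IsRadial.baseMeasure_le_coords`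
(survival function), `IsRadial.disintegration` (kernel), `IsRadial.copula_sample` (Kendall function)
and `cdf_properties`. -/

theorem mutuallySingular_map_coe {μ : Measure I} (h : μ ⟂ₘ volume) :
    μ.map ((↑) : I → ℝ) ⟂ₘ volume := by
  obtain ⟨s, hs, h1, h2⟩ := h
  have hemb : MeasurableEmbedding ((↑) : I → ℝ) := MeasurableEmbedding.subtype_coe measurableSet_Icc
  refine Measure.MutuallySingular.mk (s := (((↑) : I → ℝ) '' sᶜ)ᶜ)
    (t := ((↑) : I → ℝ) '' sᶜ) ?_ ?_ ?_
  · rw [hemb.map_apply, preimage_compl, preimage_image_eq _ Subtype.val_injective, compl_compl, h1]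
  · rw [← comap_subtype_coe_apply measurableSet_Icc]
    exact h2
  · rw [compl_union_self]

theorem continuous_cdf (μ : Measure ℝ) [IsProbabilityMeasure μ] [NullSingletonClass μ] :
    Continuous (cdf μ) := by
  rw [continuous_iff_continuousAt]
  intro x
  rw [(monotone_cdf μ).continuousAt_iff_leftLim_eq_rightLim, StieltjesFunction.rightLim_eq]
  have h := StieltjesFunction.measure_singleton (cdf μ) x
  rw [measure_cdf, measure_singleton, eq_comm, ENNReal.ofReal_eq_zero] at h
  exact le_antisymm ((monotone_cdf μ).leftLim_le le_rfl) (by linarith)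

/-- By Lebesgue differentiation the derivative is almost everywhere the Radon–Nikodym density, which
vanishes for a singular measure. -/
theorem ae_hasDerivAt_cdf_zero {μ : Measure ℝ} [IsProbabilityMeasure μ] (h : μ ⟂ₘ volume) :
    ∀ᵐ x, HasDerivAt (cdf μ) 0 x := by
  have h0 := (Measure.rnDeriv_eq_zero μ volume).2 h
  have h1 := (cdf μ).ae_hasDerivAt
  rw [measure_cdf] at h1
  filter_upwards [h0, h1] with x h2 h3
  simpa [h2] using h3

/-- The distribution function of a singular, non-atomic probability measure with full support. -/
theorem cdf_properties (μ : Measure I) [IsProbabilityMeasure μ] [NullSingletonClass μ] [μ.IsOpenPosMeasure]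
    (h : μ ⟂ₘ volume) (F : ℝ → ℝ) (hF : ∀ y, F y = μ.real {z : I | (z : ℝ) ≤ y}) :
    ContinuousOn F (Icc 0 1) ∧ StrictMonoOn F (Icc 0 1) ∧ IsSingularFun F := by
  have hm : Measurable ((↑) : I → ℝ) := measurable_subtype_coe
  have hP : IsProbabilityMeasure (μ.map ((↑) : I → ℝ)) :=
    Measure.isProbabilityMeasure_map hm.aemeasurable
  have hA : NullSingletonClass (μ.map ((↑) : I → ℝ)) := by
    refine ⟨fun x => ?_⟩
    rw [Measure.map_apply hm (measurableSet_singleton x)]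
    exact (subsingleton_singleton.preimage Subtype.val_injective).measure_zero μ
  have hFc : F = cdf (μ.map ((↑) : I → ℝ)) := by
    ext y
    rw [hF, cdf_eq_real, map_measureReal_apply hm measurableSet_Iic]
    rfl
  refine ⟨?_, ?_, ?_⟩
  · rw [hFc]
    exact (continuous_cdf _).continuousOn
  · intro a ha b hb hab
    rw [hF, hF]
    have hsub : {z : I | (z : ℝ) ≤ a} ⊆ {z : I | (z : ℝ) ≤ b} := fun z hz => le_trans hz hab.le
    have hpos : 0 < μ (Ioo (⟨a, ha⟩ : I) ⟨b, hb⟩) :=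
      isOpen_Ioo.measure_pos μ (nonempty_Ioo.2 hab)
    have hd := measureReal_sdiff (μ := μ) hsub (hm measurableSet_Iic)
    have hle : 0 < μ.real ({z : I | (z : ℝ) ≤ b} \ {z : I | (z : ℝ) ≤ a}) := by
      refine ENNReal.toReal_pos (hpos.trans_le (measure_mono ?_)).ne' (measure_ne_top _ _)
      intro z hz
      exact ⟨le_of_lt (show (z : ℝ) < b from hz.2), not_le.2 (show a < (z : ℝ) from hz.1)⟩
    linarith
  · rw [IsSingularFun, hFc]
    exact ae_restrict_of_ae (ae_hasDerivAt_cdf_zero (mutuallySingular_map_coe h))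

/-! ### The Cantor measure -/

theorem continuous_cantorFunction : Continuous (Cardinal.cantorFunction (1 / 3)) := by
  refine continuous_tsum (u := fun n => (1 / 3 : ℝ) ^ n) (fun n => ?_)
    (summable_geometric_of_lt_one (by norm_num) (by norm_num)) fun n f => ?_
  · exact (continuous_of_discreteTopology (f := fun b : Bool => cond b ((1 / 3 : ℝ) ^ n) 0)).comp
      (continuous_apply n)
  · rw [Real.norm_of_nonneg (Cardinal.cantorFunctionAux_nonneg (by norm_num)),
      Cardinal.cantorFunctionAux]
    cases f n <;> simp

/-- Self-similarity: the range K is covered by K/3 and 1 + K/3, so |K| ≤ (2/3)|K|, and |K| is finite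
by compactness. -/
theorem volume_range_cantorFunction : volume (range (Cardinal.cantorFunction (1 / 3))) = 0 := by
  set K := range (Cardinal.cantorFunction (1 / 3)) with hK
  have hfin : volume K ≠ ∞ := (isCompact_range continuous_cantorFunction).measure_lt_top.ne
  have hsub : K ⊆ ((1 / 3 : ℝ) • K) ∪ (fun x => 1 + x) '' ((1 / 3 : ℝ) • K) := by
    rintro _ ⟨f, rfl⟩
    have hmem : (1 / 3 : ℝ) * Cardinal.cantorFunction (1 / 3) (fun n => f (n + 1)) ∈
        (1 / 3 : ℝ) • K := smul_mem_smul_set (mem_range_self _)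
    rw [Cardinal.cantorFunction_succ f (by norm_num) (by norm_num)]
    cases f 0
    · left
      simpa using hmem
    · right
      exact ⟨_, hmem, by simp⟩
  have hle : volume K ≤ ENNReal.ofReal (1 / 3) * volume K + ENNReal.ofReal (1 / 3) * volume K := by
    refine (measure_mono hsub).trans ((measure_union_le _ _).trans ?_)
    rw [image_add_left, measure_preimage_add, Measure.addHaar_smul]
    simp [abs_of_pos]
  have hr := ENNReal.toReal_mono (by finiteness) hle
  rw [ENNReal.toReal_add (by finiteness) (by finiteness), ENNReal.toReal_mul,
    ENNReal.toReal_ofReal (by norm_num)] at hr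
  have h0 : (volume K).toReal = 0 := le_antisymm (by linarith) ENNReal.toReal_nonneg
  exact ((ENNReal.toReal_eq_zero_iff _).1 h0).resolve_right hfin

/-- The law of a sequence of independent fair coin tosses. -/
noncomputable def coinMeasure : Measure (ℕ → Bool) :=
  Measure.infinitePi fun _ => (PMF.uniformOfFintype Bool).toMeasure

instance : IsProbabilityMeasure coinMeasure := by
  unfold coinMeasure; infer_instance

instance : NullSingletonClass coinMeasure := by
  refine ⟨fun f => ?_⟩
  -- A single sequence lies in the cylinder fixing its first k tosses.
  have h : ∀ k : ℕ, coinMeasure {f} ≤ (1 / 2 : ℝ≥0∞) ^ k := by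
    intro k
    have := Measure.infinitePi_pi (fun _ : ℕ => (PMF.uniformOfFintype Bool).toMeasure)
      (s := Finset.range k) (t := fun i => {f i}) fun _ _ => measurableSet_singleton _
    calc coinMeasure {f} ≤ coinMeasure ((Finset.range k : Set ℕ).pi fun i => {f i}) := by
          refine measure_mono ?_
          rintro _ rfl i _
          exact rfl
      _ = (1 / 2 : ℝ≥0∞) ^ k := by
          rw [coinMeasure, this]
          simp
  exact le_antisymm (ge_of_tendsto' (ENNReal.tendsto_pow_atTop_nhds_zero_of_lt_one
    (ENNReal.div_lt_of_lt_mul (by norm_num))) h) zero_le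

/-- The image of the coin tossing measure under `x ↦ p.1 + p.2 * (Cantor function)`. -/
noncomputable def cantorMeasure (p : ℝ × ℝ) : Measure ℝ :=
  coinMeasure.map fun f => p.1 + p.2 * Cardinal.cantorFunction (1 / 3) f

theorem measurable_cantorMap (p : ℝ × ℝ) :
    Measurable fun f => p.1 + p.2 * Cardinal.cantorFunction (1 / 3) f :=
  (continuous_const.add (continuous_const.mul continuous_cantorFunction)).measurable

instance (p : ℝ × ℝ) : IsProbabilityMeasure (cantorMeasure p) :=
  Measure.isProbabilityMeasure_map (measurable_cantorMap p).aemeasurable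

theorem nullSingletonClass_cantorMeasure {p : ℝ × ℝ} (hp : p.2 ≠ 0) : NullSingletonClass (cantorMeasure p) := by
  refine ⟨fun x => ?_⟩
  rw [cantorMeasure, Measure.map_apply (measurable_cantorMap p) (measurableSet_singleton x)]
  refine (subsingleton_singleton.preimage fun f g hfg => ?_).measure_zero _
  exact Cardinal.cantorFunction_injective (by norm_num) (by norm_num)
    (mul_left_cancel₀ hp (add_left_cancel hfg))

theorem cantorMeasure_mutuallySingular (p : ℝ × ℝ) : cantorMeasure p ⟂ₘ volume := by
  have hc : IsCompact (range fun f => p.1 + p.2 * Cardinal.cantorFunction (1 / 3) f) :=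
    isCompact_range (continuous_const.add (continuous_const.mul continuous_cantorFunction))
  refine Measure.MutuallySingular.mk
    (s := (range fun f => p.1 + p.2 * Cardinal.cantorFunction (1 / 3) f)ᶜ) (t := _) ?_ ?_
    (compl_union_self _).ge
  · rw [cantorMeasure, Measure.map_apply (measurable_cantorMap p) hc.measurableSet.compl]
    simp
  · have : (range fun f => p.1 + p.2 * Cardinal.cantorFunction (1 / 3) f) =
        (fun x => p.1 + x) '' (p.2 • range (Cardinal.cantorFunction (1 / 3))) := by
      ext x
      simp only [mem_range, image_add_left, mem_preimage, mem_smul_set, exists_exists_eq_and,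
        smul_eq_mul]
      exact exists_congr fun y => by constructor <;> intro h <;> linarith
    rw [this, image_add_left, measure_preimage_add, Measure.addHaar_smul,
      volume_range_cantorFunction, mul_zero]

/-- The sharp upper bound is 3/2; the value 2 is only convenient. -/
theorem cantorFunction_mem_Icc (f : ℕ → Bool) : Cardinal.cantorFunction (1 / 3) f ∈ Icc 0 2 := by
  refine ⟨tsum_nonneg fun n => Cardinal.cantorFunctionAux_nonneg (by norm_num), ?_⟩
  refine (Cardinal.cantorFunction_le (g := fun _ => true) (by norm_num) (by norm_num)
    fun _ _ => rfl).trans ?_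
  have : Cardinal.cantorFunction (1 / 3) (fun _ => true) = ∑' n, (1 / 3 : ℝ) ^ n := by
    simp [Cardinal.cantorFunction, Cardinal.cantorFunctionAux]
  rw [this, tsum_geometric_of_lt_one (by norm_num) (by norm_num)]
  norm_num

theorem cantorMeasure_Icc {p : ℝ × ℝ} (hp : 0 < p.2) :
    cantorMeasure p (Icc p.1 (p.1 + 2 * p.2)) = 1 := by
  rw [cantorMeasure, Measure.map_apply (measurable_cantorMap p) measurableSet_Icc]
  convert measure_univ (μ := coinMeasure)
  refine eq_univ_of_forall fun f => ?_
  have := cantorFunction_mem_Icc f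
  exact ⟨by have := mul_nonneg hp.le this.1; linarith, by nlinarith [this.2]⟩

/-- There is a finite, non-atomic, singular measure on the real line with full support. -/
theorem exists_singular_openPos : ∃ κ : Measure ℝ, IsFiniteMeasure κ ∧ NullSingletonClass κ ∧
    κ.IsOpenPosMeasure ∧ κ ⟂ₘ volume := by
  obtain ⟨w, hw, hsum⟩ := ENNReal.exists_pos_sum_of_countable (one_ne_zero) (ℚ × ℕ)
  -- Small Cantor sets are placed at every rational point and at arbitrarily small scales, so each
  -- interval contains one of them entirely; the summable positive weights `w` keep the total mass
  -- finite.
  let P : ℚ × ℕ → ℝ × ℝ := fun q => ((q.1 : ℝ), 1 / ((q.2 : ℝ) + 1))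
  have hP : ∀ q, 0 < (P q).2 := fun q => Nat.one_div_pos_of_nat
  refine ⟨Measure.sum fun q => (w q : ℝ≥0∞) • cantorMeasure (P q), ⟨?_⟩, ⟨fun x => ?_⟩, ⟨?_⟩, ?_⟩
  · rw [Measure.sum_apply _ MeasurableSet.univ]
    simpa using hsum.trans ENNReal.one_lt_top
  · rw [Measure.sum_apply _ (measurableSet_singleton x)]
    have := fun q => nullSingletonClass_cantorMeasure (hP q).ne'
    simp
  · intro U hU hne h0
    obtain ⟨x, hx⟩ := hne
    obtain ⟨a, b, ⟨hax, hxb⟩, hab⟩ := mem_nhds_iff_exists_Ioo_subset.1 (hU.mem_nhds hx)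
    obtain ⟨q, hq1, hq2⟩ := exists_rat_btwn (hax.trans hxb)
    obtain ⟨m, hm⟩ := exists_nat_one_div_lt (half_pos (sub_pos.2 hq2))
    have h1 : cantorMeasure (P (q, m)) U = 0 := by
      rw [Measure.sum_apply _ hU.measurableSet, ENNReal.tsum_eq_zero] at h0
      simpa [(hw (q, m)).ne'] using h0 (q, m)
    have h2 := measure_mono_null (μ := cantorMeasure (P (q, m)))
      (s := Icc (P (q, m)).1 ((P (q, m)).1 + 2 * (P (q, m)).2)) (t := U)
      (fun y hy => hab ⟨hq1.trans_le hy.1, hy.2.trans_lt (by dsimp only [P]; linarith)⟩) h1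
    rw [cantorMeasure_Icc (hP _)] at h2
    exact one_ne_zero h2
  · exact Measure.MutuallySingular.sum_left.2 fun q =>
      (cantorMeasure_mutuallySingular _).smul _

/-! ### Images of null sets -/

/-- On the line, Lebesgue measure is one-dimensional Hausdorff measure, which a Lipschitz map
increases by at most a constant factor. -/
theorem volume_image_eq_zero {f : ℝ → ℝ} {K : ℝ≥0} {T : Set ℝ} (hf : LipschitzOnWith K f T)
    (hT : volume T = 0) : volume (f '' T) = 0 := by
  rw [← hausdorffMeasure_real] at hT ⊢
  have := hf.hausdorffMeasure_image_le (d := 1) zero_le_one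
  rw [hT, mul_zero] at this
  exact le_antisymm this zero_le

/-- Images of singular measures under maps that preserve null sets are singular. -/
theorem map_mutuallySingular {α β : Type*} [MeasureSpace α] [MeasureSpace β] {μ : Measure α}
    {f : α → β} (hf : Measurable f) {s : Set α} (hs : μ sᶜ = 0) (h : μ ⟂ₘ volume)
    (hnull : ∀ T : Set α, volume T = 0 → T ⊆ s → volume (f '' T) = 0) : μ.map f ⟂ₘ volume := by
  obtain ⟨N, -, h1, h2⟩ := h
  -- The image need not be measurable, so it is replaced by a measurable hull of the same measure.
  set T := toMeasurable volume (f '' (Nᶜ ∩ s)) with hT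
  refine Measure.MutuallySingular.mk (s := Tᶜ) (t := T) ?_ ?_ (compl_union_self _).ge
  · rw [Measure.map_apply hf (measurableSet_toMeasurable _ _).compl]
    refine measure_mono_null (t := N ∪ sᶜ) (fun x hx => ?_) (measure_union_null h1 hs)
    by_contra hx'
    rw [mem_union, not_or, notMem_compl_iff] at hx'
    exact hx (subset_toMeasurable _ _ ⟨x, hx', rfl⟩)
  · rw [hT, measure_toMeasurable]
    exact hnull _ (measure_mono_null inter_subset_left h2) inter_subset_right

/-! ### Simplices -/

/-- The solid simplex of size `t`. -/
def solidSimplex (n : ℕ) (t : ℝ) : Set (Fin n → ℝ) := {x | 0 ≤ x ∧ ∑ i, x i ≤ t}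

theorem solidSimplex_subset_Icc (n : ℕ) (t : ℝ) : solidSimplex n t ⊆ Icc 0 fun _ => t := by
  rintro x ⟨h0, h1⟩
  exact ⟨h0, fun i => (Finset.single_le_sum (fun j _ => h0 j) (Finset.mem_univ i)).trans h1⟩

theorem solidSimplex_eq_smul {n : ℕ} {t : ℝ} (ht : 0 ≤ t) :
    solidSimplex n t = t • solidSimplex n 1 := by
  ext x
  rw [mem_smul_set]
  constructor
  · intro hx
    rcases ht.eq_or_lt with rfl | ht
    · refine ⟨0, ⟨le_rfl, by simp⟩, ?_⟩
      have := solidSimplex_subset_Icc n 0 hx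
      rw [zero_smul]
      exact le_antisymm this.1 this.2
    · refine ⟨t⁻¹ • x, ⟨smul_nonneg (inv_nonneg.2 ht.le) hx.1, ?_⟩, smul_inv_smul₀ ht.ne' x⟩
      simp only [Pi.smul_apply, smul_eq_mul, ← Finset.mul_sum]
      rw [inv_mul_le_iff₀ ht, mul_one]
      exact hx.2
  · rintro ⟨y, ⟨h0, h1⟩, rfl⟩
    refine ⟨smul_nonneg ht h0, ?_⟩
    simp only [Pi.smul_apply, smul_eq_mul, ← Finset.mul_sum]
    nlinarith

/-- Only homogeneity and positivity of the volume matter; the value c = 1/n! is never needed. -/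
theorem exists_volume_solidSimplex (n : ℕ) :
    ∃ c : ℝ, 0 < c ∧ ∀ t, 0 ≤ t → volume (solidSimplex n t) = ENNReal.ofReal (c * t ^ n) := by
  have hfin : volume (solidSimplex n 1) ≠ ∞ :=
    ((measure_mono (solidSimplex_subset_Icc n 1)).trans_lt isCompact_Icc.measure_lt_top).ne
  have hpos : 0 < volume (solidSimplex n 1) := by
    have hsub : (univ.pi fun _ : Fin n => Ioo (0 : ℝ) (1 / (n + 1))) ⊆ solidSimplex n 1 := by
      intro x hx
      refine ⟨fun i => (hx i (mem_univ i)).1.le, ?_⟩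
      calc ∑ i, x i ≤ ∑ _i : Fin n, (1 / ((n : ℝ) + 1)) :=
            Finset.sum_le_sum fun i _ => (hx i (mem_univ i)).2.le
        _ = n / ((n : ℝ) + 1) := by simp [div_eq_mul_inv]
        _ ≤ 1 := by rw [div_le_one (by positivity)]; linarith
    refine lt_of_lt_of_le ?_ (measure_mono hsub)
    refine (isOpen_set_pi finite_univ fun _ _ => isOpen_Ioo).measure_pos _ ?_
    exact univ_pi_nonempty_iff.2 fun _ => nonempty_Ioo.2 (by positivity)
  refine ⟨(volume (solidSimplex n 1)).toReal, ENNReal.toReal_pos hpos.ne' hfin, fun t ht => ?_⟩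
  rw [solidSimplex_eq_smul ht, Measure.addHaar_smul, Module.finrank_fin_fun,
    abs_of_nonneg (pow_nonneg ht n), mul_comm, ENNReal.ofReal_mul ENNReal.toReal_nonneg,
    ENNReal.ofReal_toReal hfin]

/-! ### The Williamson transform -/

/-- The (unnormalized) Williamson transform of `κ`. -/
noncomputable def williamson (n : ℕ) (κ : Measure ℝ) (z : ℝ) : ℝ := ∫ r, (max (r - z) 0) ^ n ∂κ

section

variable {n : ℕ} {κ : Measure ℝ}

theorem max_sub_pow_le {r z : ℝ} (hz : 0 ≤ z) : (max (r - z) 0) ^ n ≤ (max r 0) ^ n :=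
  pow_le_pow_left₀ (le_max_right _ _) (max_le_max (by linarith) le_rfl) n

theorem integrable_williamson (hκ : Integrable (fun r => (max r 0) ^ n) κ) {z : ℝ} (hz : 0 ≤ z) :
    Integrable (fun r => (max (r - z) 0) ^ n) κ := by
  refine hκ.mono' (by fun_prop) (ae_of_all _ fun r => ?_)
  rw [Real.norm_of_nonneg (pow_nonneg (le_max_right _ _) n)]
  exact max_sub_pow_le hz

/-- Passing from a to b strictly lowers the integrand for r in (a, b), a set that `κ` charges. -/
theorem williamson_strictAntiOn (hn : n ≠ 0) [κ.IsOpenPosMeasure]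
    (hκ : Integrable (fun r => (max r 0) ^ n) κ) : StrictAntiOn (williamson n κ) (Ici 0) := by
  intro a ha b hb hab
  have hmax : ∀ r : ℝ, max (r - b) 0 ≤ max (r - a) 0 := fun r => max_le_max (by linarith) le_rfl
  have hle : ∀ r : ℝ, (max (r - b) 0) ^ n ≤ (max (r - a) 0) ^ n := fun r =>
    pow_le_pow_left₀ (le_max_right _ _) (hmax r) n
  rw [← sub_pos, williamson, williamson,
    ← integral_sub (integrable_williamson hκ ha) (integrable_williamson hκ hb),
    integral_pos_iff_support_of_nonneg (fun r => sub_nonneg.2 (hle r))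
      ((integrable_williamson hκ ha).sub (integrable_williamson hκ hb))]
  refine (isOpen_Ioo.measure_pos κ (nonempty_Ioo.2 hab)).trans_le (measure_mono fun r hr => ?_)
  rw [Function.mem_support]
  have h1 : max (r - b) 0 = 0 := max_eq_right (by linarith [hr.2])
  have h2 : max (r - a) 0 = r - a := max_eq_left (by linarith [hr.1])
  rw [h1, h2, zero_pow hn, sub_zero]
  exact pow_ne_zero _ (by linarith [hr.1])

/-- Bounding r_+^(n-1) by 1 + r_+^n makes the Lipschitz constant integrable from the n-th moment and
finiteness of `κ` alone. -/
theorem abs_pow_max_sub_le {r a b : ℝ} (ha : 0 ≤ a) (hb : 0 ≤ b) :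
    |(max (r - a) 0) ^ n - (max (r - b) 0) ^ n| ≤ n * (1 + (max r 0) ^ n) * |a - b| := by
  refine (abs_pow_sub_pow_le _ _ n).trans ?_
  have h1 : |max (r - a) 0 - max (r - b) 0| ≤ |a - b| := by
    refine (abs_max_sub_max_le_abs _ _ _).trans_eq ?_
    rw [abs_sub_comm a b]
    congr 1
    ring
  have h2 : max |max (r - a) 0| |max (r - b) 0| ≤ max r 0 := by
    rw [abs_of_nonneg (le_max_right _ _), abs_of_nonneg (le_max_right _ _)]
    exact max_le (max_le_max (by linarith) le_rfl) (max_le_max (by linarith) le_rfl)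
  have h3 : (max r 0) ^ (n - 1) ≤ 1 + (max r 0) ^ n := by
    rcases le_total (max r 0) 1 with h | h
    · linarith [pow_le_one₀ (n := n - 1) (le_max_right r 0) h, pow_nonneg (le_max_right r 0) n]
    · linarith [pow_le_pow_right₀ h (Nat.sub_le n 1)]
  have h4 := (pow_le_pow_left₀ ((abs_nonneg _).trans (le_max_left _ _)) h2 (n - 1)).trans h3
  calc _ ≤ |a - b| * n * (1 + (max r 0) ^ n) := by gcongr
    _ = _ := by ring

theorem exists_lipschitzOnWith_williamson [IsFiniteMeasure κ]
    (hκ : Integrable (fun r => (max r 0) ^ n) κ) :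
    ∃ K, LipschitzOnWith K (williamson n κ) (Ici 0) := by
  refine ⟨(∫ r, (n : ℝ) * (1 + (max r 0) ^ n) ∂κ).toNNReal, LipschitzOnWith.of_dist_le_mul ?_⟩
  intro a ha b hb
  have hi : Integrable (fun r => (n : ℝ) * (1 + (max r 0) ^ n)) κ :=
    ((integrable_const (1 : ℝ)).add hκ).const_mul _
  rw [Real.coe_toNNReal _ (integral_nonneg fun r => by positivity), Real.dist_eq, Real.dist_eq,
    williamson, williamson,
    ← integral_sub (integrable_williamson hκ ha) (integrable_williamson hκ hb),
    ← integral_mul_const]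
  refine (abs_integral_le_integral_abs).trans (integral_mono_of_nonneg
    (ae_of_all _ fun r => abs_nonneg _) (hi.mul_const _) (ae_of_all _ fun r => ?_))
  exact abs_pow_max_sub_le ha hb

theorem tendsto_williamson (hn : n ≠ 0) (hκ : Integrable (fun r => (max r 0) ^ n) κ) :
    Tendsto (williamson n κ) atTop (𝓝 0) := by
  have : Tendsto (williamson n κ) atTop (𝓝 (∫ _, 0 ∂κ)) := by
    refine tendsto_integral_filter_of_dominated_convergence (fun r => (max r 0) ^ n)
      (Eventually.of_forall fun z => by fun_prop) ?_ hκ (ae_of_all _ fun r => ?_)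
    · filter_upwards [eventually_ge_atTop 0] with z hz
      refine ae_of_all _ fun r => ?_
      rw [Real.norm_of_nonneg (pow_nonneg (le_max_right _ _) n)]
      exact max_sub_pow_le hz
    · refine tendsto_const_nhds.congr' ?_
      filter_upwards [eventually_ge_atTop r] with z hz
      rw [max_eq_right (by linarith), zero_pow hn]
  simpa using this

theorem williamson_nonneg (z : ℝ) : 0 ≤ williamson n κ z :=
  integral_nonneg fun _ => pow_nonneg (le_max_right _ _) n

theorem williamson_pos (hn : n ≠ 0) [κ.IsOpenPosMeasure]
    (hκ : Integrable (fun r => (max r 0) ^ n) κ) {z : ℝ} (hz : 0 ≤ z) : 0 < williamson n κ z :=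
  (williamson_nonneg (z + 1)).trans_lt (williamson_strictAntiOn hn hκ hz
    (mem_Ici.2 (by linarith)) (by linarith))

/-- This supplies two free parameters, a dilation and a mass, to meet the two normalizations in
`IsRadial`. -/
theorem williamson_smul_map {a s : ℝ} (ha : 0 < a) (hs : 0 ≤ s) (z : ℝ) :
    williamson n (ENNReal.ofReal s • κ.map fun r => r / a) z =
      s / a ^ n * williamson n κ (a * z) := by
  rw [williamson, integral_smul_measure, integral_map (by fun_prop) (by fun_prop),
    ENNReal.toReal_ofReal hs, smul_eq_mul, div_mul_eq_mul_div, mul_div_assoc, williamson,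
    ← integral_div]
  congr 2
  ext r
  rw [← div_pow, ← max_div_div_right ha.le, zero_div, sub_div, mul_div_cancel_left₀ z ha.ne']

end

/-- A finite measure whose Williamson transform (normalized by the constant `c`) generates a
copula with the properties we look for. -/
structure IsRadial (n : ℕ) (c : ℝ) (κ : Measure ℝ) : Prop where
  finite : IsFiniteMeasure κ
  nullSingleton : NullSingletonClass κ
  openPos : κ.IsOpenPosMeasure
  singular : κ ⟂ₘ volume
  integrable : Integrable (fun r => (max r 0) ^ n) κ
  map_zero : c * williamson n κ 0 = 1
  map_one : c * williamson n κ 1 = 1 / 2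

theorem exists_singular_openPos_integrable (n : ℕ) : ∃ κ : Measure ℝ, IsFiniteMeasure κ ∧
    NullSingletonClass κ ∧ κ.IsOpenPosMeasure ∧ κ ⟂ₘ volume ∧
    Integrable (fun r => (max r 0) ^ n) κ := by
  obtain ⟨κ, hf, hs, ho, hsing⟩ := exists_singular_openPos
  have hle : ∀ r : ℝ, 1 / (1 + |r|) ^ n ≤ 1 := fun r => by
    rw [div_le_one (by positivity)]
    exact one_le_pow₀ (by linarith [abs_nonneg r])
  -- This density makes the n-th moment finite; being strictly positive, it leaves the null sets of
  -- `κ` unchanged, hence also full support, non-atomicity and singularity.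
  have hm : Measurable fun r : ℝ => ENNReal.ofReal (1 / (1 + |r|) ^ n) := by fun_prop
  have hac : κ.withDensity (fun r => ENNReal.ofReal (1 / (1 + |r|) ^ n)) ≪ κ :=
    withDensity_absolutelyContinuous _ _
  have hac' : κ ≪ κ.withDensity (fun r => ENNReal.ofReal (1 / (1 + |r|) ^ n)) :=
    withDensity_absolutelyContinuous' hm.aemeasurable
      (ae_of_all _ fun r => (ENNReal.ofReal_pos.2 (by positivity)).ne')
  refine ⟨κ.withDensity fun r => ENNReal.ofReal (1 / (1 + |r|) ^ n), ?_, ⟨fun x => ?_⟩,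
    hac'.isOpenPosMeasure, hsing.mono_ac hac .rfl, ?_⟩
  · refine isFiniteMeasure_withDensity (ne_top_of_le_ne_top (measure_ne_top κ univ) ?_)
    refine (lintegral_mono (g := fun _ => 1) fun r => ?_).trans (by simp)
    exact ENNReal.ofReal_le_one.2 (hle r)
  · exact hac (measure_singleton x)
  · rw [integrable_withDensity_iff hm (ae_of_all _ fun r => ENNReal.ofReal_lt_top)]
    refine (integrable_const (1 : ℝ)).mono' (by fun_prop) (ae_of_all _ fun r => ?_)
    rw [ENNReal.toReal_ofReal (by positivity), Real.norm_of_nonneg (by positivity), one_div,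
      ← div_eq_mul_inv, ← div_pow]
    refine pow_le_one₀ (by positivity) ?_
    rw [div_le_one (by positivity)]
    exact max_le (by linarith [le_abs_self r]) (by positivity)

theorem exists_isRadial {n : ℕ} (hn : n ≠ 0) {c : ℝ} (hc : 0 < c) : ∃ κ, IsRadial n c κ := by
  obtain ⟨κ, hf, hs, ho, hsing, hi⟩ := exists_singular_openPos_integrable n
  have hw0 := williamson_pos hn hi le_rfl
  obtain ⟨K, hK⟩ := exists_lipschitzOnWith_williamson hi
  obtain ⟨b, hb, hb0⟩ : ∃ b, williamson n κ b < williamson n κ 0 / 2 ∧ 0 ≤ b :=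
    (((tendsto_williamson hn hi).eventually_lt_const (half_pos hw0)).and
      (eventually_ge_atTop 0)).exists
  -- The dilation by a moves the point where the transform has halved to 1; the mass s below then
  -- fixes the value at 0.
  obtain ⟨a, ha, hab⟩ : williamson n κ 0 / 2 ∈ williamson n κ '' Icc 0 b :=
    intermediate_value_Icc' hb0 (hK.continuousOn.mono Icc_subset_Ici_self) ⟨hb.le, by linarith⟩
  have ha0 : 0 < a := by
    refine lt_of_le_of_ne ha.1 ?_
    rintro rfl
    linarith
  set s : ℝ := a ^ n / (c * williamson n κ 0) with hs_def
  have hs0 : 0 < s := by positivity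
  have hsne : ENNReal.ofReal s ≠ 0 := (ENNReal.ofReal_pos.2 hs0).ne'
  have hmeas : MeasurableEmbedding fun r : ℝ => r / a := by
    simpa [div_eq_mul_inv] using measurableEmbedding_mulRight₀ (inv_ne_zero ha0.ne')
  have hv : ∀ z, williamson n (ENNReal.ofReal s • κ.map fun r => r / a) z =
      s / a ^ n * williamson n κ (a * z) := williamson_smul_map ha0 hs0.le
  refine ⟨ENNReal.ofReal s • κ.map fun r => r / a, ?_, ?_, ?_, ?_, ?_, ?_, ?_⟩
  · have : IsFiniteMeasure (κ.map fun r => r / a) := inferInstance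
    exact Measure.smul_finite _ ENNReal.ofReal_ne_top
  · refine ⟨fun x => ?_⟩
    rw [Measure.smul_apply, hmeas.map_apply,
      (subsingleton_singleton.preimage hmeas.injective).measure_zero, smul_zero]
  · have : (κ.map fun r => r / a).IsOpenPosMeasure :=
      (continuous_id.div_const a).isOpenPosMeasure_map (fun y => ⟨y * a, by field_simp; simp⟩)
    exact Measure.isOpenPosMeasure_smul _ hsne
  · refine Measure.MutuallySingular.smul _ ?_
    have hL : LipschitzOnWith (Real.nnabs a⁻¹) (fun r : ℝ => r / a) univ :=
      LipschitzOnWith.of_dist_le_mul fun x _ y _ => by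
        rw [Real.dist_eq, Real.dist_eq, ← sub_div, abs_div, Real.coe_nnabs, abs_inv, mul_comm,
          div_eq_mul_inv]
    exact map_mutuallySingular hmeas.measurable (s := univ) (by simp) hsing
      fun T hT _ => volume_image_eq_zero (hL.mono (subset_univ T)) hT
  · refine Integrable.smul_measure ?_ ENNReal.ofReal_ne_top
    rw [hmeas.integrable_map_iff]
    refine (hi.div_const (a ^ n)).congr (ae_of_all _ fun r => ?_)
    simp only [Function.comp_apply]
    rw [← div_pow, ← max_div_div_right ha0.le, zero_div]
  · rw [hv, mul_zero, hs_def]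
    field_simp
  · rw [hv, mul_one, hab, hs_def]
    field_simp

/-! ### The generator -/

/-- The normalized Williamson transform, as a map to `[0,1]`. -/
noncomputable def gen (n : ℕ) (c : ℝ) (κ : Measure ℝ) (z : ℝ) : I :=
  projIcc 0 1 zero_le_one (c * williamson n κ (max z 0))

/-- The restriction of `gen` to `[0,∞)`. -/
noncomputable def genNN (n : ℕ) (c : ℝ) (κ : Measure ℝ) (z : ℝ≥0) : I := gen n c κ z

/-- The inverse of `gen`. -/
noncomputable def invGen (n : ℕ) (c : ℝ) (κ : Measure ℝ) (y : I) : ℝ :=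
  (pseudoInverse (genNN n c κ) y).toReal

namespace IsRadial

variable {n : ℕ} {c : ℝ} {κ : Measure ℝ}

/-- The truncations in `gen` are inactive on [0, ∞), by monotonicity and the normalization at 0. -/
theorem coe_gen (hn : n ≠ 0) (hc : 0 < c) (h : IsRadial n c κ) {z : ℝ} (hz : 0 ≤ z) :
    (gen n c κ z : ℝ) = c * williamson n κ z := by
  have := h.openPos
  rw [gen, max_eq_left hz, projIcc_of_mem]
  refine ⟨mul_nonneg hc.le (williamson_nonneg z), ?_⟩
  rw [← h.map_zero]
  exact mul_le_mul_of_nonneg_left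
    ((williamson_strictAntiOn hn h.integrable).antitoneOn (mem_Ici.2 le_rfl) hz hz) hc.le

theorem continuous_gen (h : IsRadial n c κ) : Continuous (gen n c κ) := by
  have := h.finite
  obtain ⟨K, hK⟩ := exists_lipschitzOnWith_williamson h.integrable
  exact continuous_projIcc.comp (continuous_const.mul
    (hK.continuousOn.comp_continuous (continuous_id.max continuous_const) fun z =>
      mem_Ici.2 (le_max_right _ _)))

theorem gen_zero (hn : n ≠ 0) (hc : 0 < c) (h : IsRadial n c κ) : gen n c κ 0 = 1 :=
  Subtype.ext (by rw [coe_gen hn hc h le_rfl, h.map_zero]; rfl)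

theorem gen_pos (hn : n ≠ 0) (hc : 0 < c) (h : IsRadial n c κ) {z : ℝ} (hz : 0 ≤ z) :
    0 < gen n c κ z := by
  have := h.openPos
  rw [← Subtype.coe_lt_coe, coe_gen hn hc h hz]
  exact mul_pos hc (williamson_pos hn h.integrable hz)

theorem strictAntiOn_gen (hn : n ≠ 0) (hc : 0 < c) (h : IsRadial n c κ) :
    StrictAntiOn (gen n c κ) (Ici 0) := by
  have := h.openPos
  intro a ha b hb hab
  rw [← Subtype.coe_lt_coe, coe_gen hn hc h ha, coe_gen hn hc h hb]
  exact mul_lt_mul_of_pos_left (williamson_strictAntiOn hn h.integrable ha hb hab) hc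

theorem exists_lipschitzOnWith_gen (hn : n ≠ 0) (hc : 0 < c) (h : IsRadial n c κ) :
    ∃ K, LipschitzOnWith K (fun z => (gen n c κ z : ℝ)) (Ici 0) := by
  have := h.finite
  obtain ⟨K, hK⟩ := exists_lipschitzOnWith_williamson h.integrable
  refine ⟨Real.nnabs c * K, LipschitzOnWith.of_dist_le_mul fun x hx y hy => ?_⟩
  have := hK.dist_le_mul x hx y hy
  rw [coe_gen hn hc h hx, coe_gen hn hc h hy, Real.dist_eq, ← mul_sub, abs_mul, NNReal.coe_mul,
    Real.coe_nnabs, mul_assoc]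
  exact mul_le_mul_of_nonneg_left this (abs_nonneg c)

theorem tendsto_gen (hn : n ≠ 0) (hc : 0 < c) (h : IsRadial n c κ) :
    Tendsto (gen n c κ) atTop (𝓝 0) := by
  rw [tendsto_subtype_rng]
  have := (tendsto_williamson hn h.integrable).const_mul c
  rw [mul_zero] at this
  refine this.congr' ?_
  filter_upwards [eventually_ge_atTop 0] with z hz
  exact (coe_gen hn hc h hz).symm

theorem exists_gen_eq (hn : n ≠ 0) (hc : 0 < c) (h : IsRadial n c κ) {y : I} (hy : y ≠ 0) :
    ∃ a, 0 ≤ a ∧ gen n c κ a = y := by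
  obtain ⟨b, hb, hb0⟩ : ∃ b, gen n c κ b < y ∧ 0 ≤ b :=
    (((tendsto_gen hn hc h).eventually_lt_const (unitInterval.pos_iff_ne_zero.2 hy)).and
      (eventually_ge_atTop 0)).exists
  obtain ⟨a, ha, hay⟩ : y ∈ gen n c κ '' Icc 0 b :=
    intermediate_value_Icc' hb0 h.continuous_gen.continuousOn
      ⟨hb.le, (gen_zero hn hc h).symm ▸ unitInterval.le_one'⟩
  exact ⟨a, ha.1, hay⟩

theorem exists_gen_eq_of_lt_one (hn : n ≠ 0) (hc : 0 < c) (h : IsRadial n c κ) {y : I}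
    (hy : y ∈ Ioo (0 : I) 1) : ∃ a, 0 < a ∧ gen n c κ a = y := by
  obtain ⟨a, ha, rfl⟩ := exists_gen_eq hn hc h hy.1.ne'
  refine ⟨a, ha.lt_of_ne ?_, rfl⟩
  rintro rfl
  exact hy.2.ne (gen_zero hn hc h)

theorem extendTop_genNN_ofReal {a : ℝ} (ha : 0 ≤ a) :
    extendTop (genNN n c κ) (ENNReal.ofReal a) = gen n c κ a := by
  rw [extendTop, if_neg ENNReal.ofReal_ne_top, genNN]
  congr 1
  exact Real.coe_toNNReal a ha

/-- The transform never vanishes at a finite point, so the generator is strict and its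
pseudo-inverse is a genuine inverse between [0, 1] and [0, ∞]. -/
theorem strictAnti_extendTop (hn : n ≠ 0) (hc : 0 < c) (h : IsRadial n c κ) :
    StrictAnti (extendTop (genNN n c κ)) := by
  intro a b hab
  lift a to ℝ≥0 using hab.ne_top
  rw [extendTop, extendTop, if_neg ENNReal.coe_ne_top, ENNReal.toNNReal_coe]
  split_ifs with hb
  · exact gen_pos hn hc h a.2
  · lift b to ℝ≥0 using hb
    exact strictAntiOn_gen hn hc h a.2 b.2 (by exact_mod_cast hab)

theorem isGenerator_genNN (hn : n ≠ 0) (hc : 0 < c) (h : IsRadial n c κ) :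
    IsGenerator (genNN n c κ) where
  continuous := h.continuous_gen.comp NNReal.continuous_coe
  antitone a b hab := (strictAntiOn_gen hn hc h).antitoneOn a.2 b.2 hab
  map_zero := gen_zero hn hc h
  tendsto := (tendsto_gen hn hc h).comp (NNReal.tendsto_coe_atTop.2 tendsto_id)
  strictAntiOn := (strictAnti_extendTop hn hc h).strictAntiOn _
  normalized := by
    rw [genNN, NNReal.coe_one, coe_gen hn hc h zero_le_one, h.map_one]

theorem pseudoInverse_extendTop (hn : n ≠ 0) (hc : 0 < c) (h : IsRadial n c κ) (z : ℝ≥0∞) :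
    pseudoInverse (genNN n c κ) (extendTop (genNN n c κ) z) = z := by
  have : {w | extendTop (genNN n c κ) w = extendTop (genNN n c κ) z} = {z} := by
    ext w
    exact (strictAnti_extendTop hn hc h).injective.eq_iff
  rw [pseudoInverse, this, sInf_singleton]

theorem pseudoInverse_gen (hn : n ≠ 0) (hc : 0 < c) (h : IsRadial n c κ) {a : ℝ} (ha : 0 ≤ a) :
    pseudoInverse (genNN n c κ) (gen n c κ a) = ENNReal.ofReal a := by
  rw [← extendTop_genNN_ofReal ha, pseudoInverse_extendTop hn hc h]

theorem pseudoInverse_zero (hn : n ≠ 0) (hc : 0 < c) (h : IsRadial n c κ) :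
    pseudoInverse (genNN n c κ) 0 = ∞ := by
  have h0 : extendTop (genNN n c κ) ∞ = 0 := if_pos rfl
  rw [← h0, pseudoInverse_extendTop hn hc h]

theorem invGen_gen (hn : n ≠ 0) (hc : 0 < c) (h : IsRadial n c κ) {a : ℝ} (ha : 0 ≤ a) :
    invGen n c κ (gen n c κ a) = a := by
  rw [invGen, pseudoInverse_gen hn hc h ha, ENNReal.toReal_ofReal ha]

theorem surjective_extendTop (hn : n ≠ 0) (hc : 0 < c) (h : IsRadial n c κ) :
    Function.Surjective (extendTop (genNN n c κ)) := by
  intro y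
  rcases eq_or_ne y 0 with rfl | hy
  · exact ⟨∞, if_pos rfl⟩
  · obtain ⟨a, ha, rfl⟩ := exists_gen_eq hn hc h hy
    exact ⟨_, extendTop_genNN_ofReal ha⟩

theorem measurable_pseudoInverse (hn : n ≠ 0) (hc : 0 < c) (h : IsRadial n c κ) :
    Measurable (pseudoInverse (genNN n c κ)) := by
  have : Antitone (pseudoInverse (genNN n c κ)) := by
    intro x y hxy
    obtain ⟨a, rfl⟩ := surjective_extendTop hn hc h x
    obtain ⟨b, rfl⟩ := surjective_extendTop hn hc h y
    rw [pseudoInverse_extendTop hn hc h, pseudoInverse_extendTop hn hc h]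
    exact (strictAnti_extendTop hn hc h).le_iff_ge.1 hxy
  exact this.measurable

theorem measurable_invGen (hn : n ≠ 0) (hc : 0 < c) (h : IsRadial n c κ) :
    Measurable (invGen n c κ) :=
  (measurable_pseudoInverse hn hc h).ennreal_toReal

/-- The image under `gen` of a singular measure on `[0,∞)` is singular. -/
theorem map_gen_mutuallySingular (hn : n ≠ 0) (hc : 0 < c) (h : IsRadial n c κ) {ν : Measure ℝ}
    (hν : ν (Ici 0)ᶜ = 0) (hs : ν ⟂ₘ volume) : ν.map (gen n c κ) ⟂ₘ volume := by
  obtain ⟨K, hK⟩ := exists_lipschitzOnWith_gen hn hc h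
  refine map_mutuallySingular h.continuous_gen.measurable hν hs fun T hT hT0 => ?_
  have := volume_image_eq_zero (hK.mono hT0) hT
  rw [← image_image] at this
  rwa [← comap_subtype_coe_apply measurableSet_Icc] at this

theorem nullSingletonClass_map_gen (hn : n ≠ 0) (hc : 0 < c) (h : IsRadial n c κ) {ν : Measure ℝ}
    [NullSingletonClass ν] (hν : ν (Ici 0)ᶜ = 0) : NullSingletonClass (ν.map (gen n c κ)) := by
  refine ⟨fun y => ?_⟩
  rw [Measure.map_apply h.continuous_gen.measurable (measurableSet_singleton y)]
  have hsub : (gen n c κ ⁻¹' {y} ∩ Ici 0).Subsingleton := fun a ha b hb =>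
    (strictAntiOn_gen hn hc h).injOn ha.2 hb.2 (ha.1.trans hb.1.symm)
  refine measure_mono_null (t := (gen n c κ ⁻¹' {y} ∩ Ici 0) ∪ (Ici 0)ᶜ) (fun a ha => ?_)
    (measure_union_null (hsub.measure_zero ν) hν)
  by_cases h0 : a ∈ Ici 0
  · exact Or.inl ⟨ha, h0⟩
  · exact Or.inr h0

/-- Every point of (0, 1), a dense subset, is a value of the generator at some a > 0. -/
theorem exists_gen_mem_of_isOpen (hn : n ≠ 0) (hc : 0 < c) (h : IsRadial n c κ) {O : Set I}
    (hO : IsOpen O) (hne : O.Nonempty) : ∃ a, 0 < a ∧ gen n c κ a ∈ O := by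
  have hd : Dense (Ioo (0 : I) 1) := by
    rw [dense_iff_closure_eq, closure_Ioo zero_ne_one]
    exact eq_univ_of_forall fun y => ⟨unitInterval.nonneg', unitInterval.le_one'⟩
  obtain ⟨y, hyO, hy⟩ := hd.inter_open_nonempty O hO hne
  obtain ⟨a, ha, rfl⟩ := exists_gen_eq_of_lt_one hn hc h hy
  exact ⟨a, ha, hyO⟩

theorem isOpenPosMeasure_map_gen (hn : n ≠ 0) (hc : 0 < c) (h : IsRadial n c κ) {ν : Measure ℝ}
    (hν : ∀ O, IsOpen O → (O ∩ Ioi 0).Nonempty → ν O ≠ 0) :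
    (ν.map (gen n c κ)).IsOpenPosMeasure := by
  refine ⟨fun O hO hne => ?_⟩
  rw [Measure.map_apply h.continuous_gen.measurable hO.measurableSet]
  obtain ⟨a, ha, haO⟩ := exists_gen_mem_of_isOpen hn hc h hO hne
  exact hν _ (hO.preimage h.continuous_gen) ⟨a, haO, ha⟩

end IsRadial

/-! ### The copula -/

/-- The pairs `(x, r)` such that `x` lies in the solid simplex of size `r`. -/
def simplexDomain (n : ℕ) : Set ((Fin n → ℝ) × ℝ) := {p | 0 ≤ p.1 ∧ ∑ i, p.1 i ≤ p.2}

/-- The joint law of `(X₁, …, Xₙ)` and `X₁ + ⋯ + Xₙ₊₁`. -/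
noncomputable def baseMeasure (n : ℕ) (κ : Measure ℝ) : Measure ((Fin n → ℝ) × ℝ) :=
  (volume.prod κ).restrict (simplexDomain n)

/-- The vector `(X₁, …, Xₙ₊₁)`. -/
def coords {n : ℕ} (p : (Fin n → ℝ) × ℝ) : Fin (n + 1) → ℝ :=
  Fin.snoc p.1 (p.2 - ∑ i, p.1 i)

/-- The random vector whose law is the measure of the copula. -/
noncomputable def sample (n : ℕ) (c : ℝ) (κ : Measure ℝ) (p : (Fin n → ℝ) × ℝ) : Fin (n + 1) → I :=
  fun i => gen n c κ (coords p i)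

variable {n : ℕ} {c : ℝ} {κ : Measure ℝ}

theorem measurableSet_simplexDomain : MeasurableSet (simplexDomain n) :=
  ((isClosed_le continuous_const continuous_fst).inter
    (isClosed_le (continuous_finsetSum _ fun i _ => (continuous_apply i).comp continuous_fst)
      continuous_snd)).measurableSet

theorem ae_mem_simplexDomain : ∀ᵐ p ∂baseMeasure n κ, p ∈ simplexDomain n :=
  ae_restrict_mem measurableSet_simplexDomain

theorem continuous_coords : Continuous (coords (n := n)) := by
  refine continuous_pi fun i => ?_
  refine Fin.lastCases ?_ (fun j => ?_) i
  · simp only [coords, Fin.snoc_last]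
    exact continuous_snd.sub
      (continuous_finsetSum _ fun i _ => (continuous_apply i).comp continuous_fst)
  · simp only [coords, Fin.snoc_castSucc]
    exact (continuous_apply j).comp continuous_fst

theorem sum_coords (p : (Fin n → ℝ) × ℝ) : ∑ i, coords p i = p.2 := by
  simp [Fin.sum_univ_castSucc, coords]

theorem le_coords_iff {a : Fin (n + 1) → ℝ} {p : (Fin n → ℝ) × ℝ} :
    a ≤ coords p ↔ (∀ i : Fin n, a i.castSucc ≤ p.1 i) ∧ a (Fin.last n) ≤ p.2 - ∑ i, p.1 i := by
  rw [Pi.le_def, Fin.forall_fin_succ']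
  simp [coords]

theorem mem_simplexDomain_iff {p : (Fin n → ℝ) × ℝ} : p ∈ simplexDomain n ↔ 0 ≤ coords p := by
  rw [le_coords_iff]
  simp [simplexDomain, Pi.le_def]

/-- Tonelli with x outermost exhibits the law of r given x as `κ` conditioned on [∑ x_i, ∞). -/
theorem lintegral_baseMeasure [SFinite κ] {F : (Fin n → ℝ) × ℝ → ℝ≥0∞} (hF : Measurable F) :
    ∫⁻ p, F p ∂baseMeasure n κ =
      ∫⁻ x in {x | 0 ≤ x}, ∫⁻ r in Ici (∑ i, x i), F (x, r) ∂κ := by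
  rw [baseMeasure, ← lintegral_indicator measurableSet_simplexDomain,
    lintegral_prod _ (hF.indicator measurableSet_simplexDomain).aemeasurable,
    ← lintegral_indicator (s := {x : Fin n → ℝ | 0 ≤ x}) measurableSet_Ici]
  refine lintegral_congr fun x => ?_
  by_cases hx : 0 ≤ x
  · rw [indicator_of_mem (show x ∈ {x | 0 ≤ x} from hx), ← lintegral_indicator measurableSet_Ici]
    refine lintegral_congr fun r => ?_
    by_cases hr : ∑ i, x i ≤ r
    · rw [indicator_of_mem (show (x, r) ∈ simplexDomain n from ⟨hx, hr⟩),
        indicator_of_mem (show r ∈ Ici _ from hr)]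
    · rw [indicator_of_notMem (fun h => hr h.2), indicator_of_notMem (show r ∉ Ici _ from hr)]
  · rw [indicator_of_notMem (show x ∉ {x | 0 ≤ x} from hx)]
    refine (lintegral_congr fun r => ?_).trans lintegral_zero
    exact indicator_of_notMem (fun h => hx h.1) _

theorem volume_solidSimplex (hn : n ≠ 0)
    (hvol : ∀ t, 0 ≤ t → volume (solidSimplex n t) = ENNReal.ofReal (c * t ^ n)) (t : ℝ) :
    volume (solidSimplex n t) = ENNReal.ofReal (c * (max t 0) ^ n) := by
  rcases le_or_gt 0 t with ht | ht
  · rw [max_eq_left ht, hvol t ht]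
  · have : solidSimplex n t = ∅ := eq_empty_of_forall_notMem fun x hx =>
      (hx.2.trans_lt ht).not_ge (Finset.sum_nonneg fun i _ => hx.1 i)
    rw [this, max_eq_right ht.le, zero_pow hn]
    simp

namespace IsRadial

theorem continuous_sample (h : IsRadial n c κ) : Continuous (sample n c κ) :=
  continuous_pi fun i => h.continuous_gen.comp ((continuous_apply i).comp continuous_coords)

/-- The joint survival function of `(X₁, …, Xₙ₊₁)`. -/
theorem baseMeasure_le_coords (hn : n ≠ 0) (hc : 0 < c) (h : IsRadial n c κ)
    (hvol : ∀ t, 0 ≤ t → volume (solidSimplex n t) = ENNReal.ofReal (c * t ^ n))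
    {a : Fin (n + 1) → ℝ} (ha : 0 ≤ a) :
    baseMeasure n κ {p | a ≤ coords p} = ENNReal.ofReal (c * williamson n κ (∑ i, a i)) := by
  have := h.finite
  have hmeas : MeasurableSet {p : (Fin n → ℝ) × ℝ | a ≤ coords p} :=
    (isClosed_le continuous_const continuous_coords).measurableSet
  have hsub : {p : (Fin n → ℝ) × ℝ | a ≤ coords p} ⊆ simplexDomain n := fun p hp =>
    mem_simplexDomain_iff.2 (ha.trans hp)
  -- At fixed r, subtracting the lower bounds turns the slice into a solid simplex of size r - ∑
  -- a_i, the last bound being absorbed in the size.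
  have hslice : ∀ r : ℝ, (fun x => (x, r)) ⁻¹' {p : (Fin n → ℝ) × ℝ | a ≤ coords p} =
      (fun x => -(fun i : Fin n => a i.castSucc) + x) ⁻¹' solidSimplex n (r - ∑ i, a i) := by
    intro r
    ext x
    rw [mem_preimage, mem_ofPred_eq, le_coords_iff]
    simp only [mem_preimage, mem_ofPred_eq, solidSimplex, Pi.le_def, Pi.add_apply,
      Pi.neg_apply, Pi.zero_apply, Finset.sum_add_distrib, Finset.sum_neg_distrib,
      Fin.sum_univ_castSucc]
    refine and_congr (forall_congr' fun i => ?_) ?_ <;> constructor <;> intro h <;> linarith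
  rw [baseMeasure, Measure.restrict_apply hmeas, inter_eq_left.2 hsub,
    Measure.prod_apply_symm hmeas]
  simp_rw [hslice, measure_preimage_add, volume_solidSimplex hn hvol]
  rw [williamson, ← integral_const_mul, ofReal_integral_eq_lintegral_ofReal]
  · exact (integrable_williamson h.integrable (Finset.sum_nonneg fun i _ => ha i)).const_mul c
  · exact ae_of_all _ fun r => mul_nonneg hc.le (pow_nonneg (le_max_right _ _) n)

theorem isProbabilityMeasure_baseMeasure (hn : n ≠ 0) (hc : 0 < c) (h : IsRadial n c κ)
    (hvol : ∀ t, 0 ≤ t → volume (solidSimplex n t) = ENNReal.ofReal (c * t ^ n)) :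
    IsProbabilityMeasure (baseMeasure n κ) := by
  refine ⟨?_⟩
  have h0 := baseMeasure_le_coords hn hc h hvol (a := 0) le_rfl
  simp only [Pi.zero_apply, Finset.sum_const_zero, h.map_zero, ENNReal.ofReal_one] at h0
  rw [← h0]
  refine measure_congr (eventuallyEq_set.2 ?_)
  filter_upwards [ae_mem_simplexDomain] with p hp
  simpa using mem_simplexDomain_iff.1 hp

/-- The generator reverses order, so lower boxes for the sample are upper orthants for `coords`. A
zero coordinate of u is separate: it has no finite preimage, and both sides vanish. -/
theorem baseMeasure_sample_Iic (hn : n ≠ 0) (hc : 0 < c) (h : IsRadial n c κ)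
    (hvol : ∀ t, 0 ≤ t → volume (solidSimplex n t) = ENNReal.ofReal (c * t ^ n))
    (u : Fin (n + 1) → I) :
    (baseMeasure n κ).map (sample n c κ) (Iic u) = ENNReal.ofReal
      (extendTop (genNN n c κ) (∑ i, pseudoInverse (genNN n c κ) (u i))) := by
  rw [Measure.map_apply h.continuous_sample.measurable measurableSet_Iic]
  by_cases hu : ∃ i, u i = 0
  · obtain ⟨i, hi⟩ := hu
    have htop : ∑ i, pseudoInverse (genNN n c κ) (u i) = ∞ :=
      ENNReal.sum_eq_top.2 ⟨i, Finset.mem_univ i, by rw [hi, pseudoInverse_zero hn hc h]⟩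
    rw [htop, extendTop, if_pos rfl]
    refine (measure_eq_zero_iff_ae_notMem.2 ?_).trans (by simp)
    filter_upwards [ae_mem_simplexDomain] with p hp hle
    have := gen_pos hn hc h (mem_simplexDomain_iff.1 hp i)
    exact this.not_ge ((hle i).trans_eq hi)
  · push Not at hu
    choose a ha hau using fun i => exists_gen_eq hn hc h (hu i)
    have hsum : ∑ i, pseudoInverse (genNN n c κ) (u i) = ENNReal.ofReal (∑ i, a i) := by
      rw [ENNReal.ofReal_sum_of_nonneg fun i _ => ha i]
      exact Finset.sum_congr rfl fun i _ => by rw [← hau i, pseudoInverse_gen hn hc h (ha i)]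
    have hs0 : 0 ≤ ∑ i, a i := Finset.sum_nonneg fun i _ => ha i
    rw [hsum, extendTop_genNN_ofReal hs0, coe_gen hn hc h hs0,
      ← baseMeasure_le_coords hn hc h hvol ha]
    refine measure_congr (eventuallyEq_set.2 ?_)
    filter_upwards [ae_mem_simplexDomain] with p hp
    simp only [mem_preimage, mem_Iic, Pi.le_def, sample]
    refine forall_congr' fun i => ?_
    rw [← hau i]
    exact (strictAntiOn_gen hn hc h).le_iff_ge (mem_simplexDomain_iff.1 hp i) (ha i)

theorem extendTop_pseudoInverse (hn : n ≠ 0) (hc : 0 < c) (h : IsRadial n c κ) (y : I) :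
    extendTop (genNN n c κ) (pseudoInverse (genNN n c κ) y) = y := by
  obtain ⟨z, rfl⟩ := surjective_extendTop hn hc h y
  rw [pseudoInverse_extendTop hn hc h]

/-- The Archimedean copula generated by the Williamson transform of `κ`. -/
noncomputable def copula (hn : n ≠ 0) (hc : 0 < c) (h : IsRadial n c κ)
    (hvol : ∀ t, 0 ≤ t → volume (solidSimplex n t) = ENNReal.ofReal (c * t ^ n)) :
    Copula (n + 1) where
  toFun u := extendTop (genNN n c κ) (∑ i, pseudoInverse (genNN n c κ) (u i))
  exists_measure := by
    have := isProbabilityMeasure_baseMeasure hn hc h hvol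
    have hP : IsProbabilityMeasure ((baseMeasure n κ).map (sample n c κ)) :=
      Measure.isProbabilityMeasure_map h.continuous_sample.aemeasurable
    refine ⟨(baseMeasure n κ).map (sample n c κ), hP, fun i => ?_,
      baseMeasure_sample_Iic hn hc h hvol⟩
    have hPi : IsProbabilityMeasure
        (((baseMeasure n κ).map (sample n c κ)).map fun x => x i) :=
      Measure.isProbabilityMeasure_map (measurable_pi_apply i).aemeasurable
    refine Measure.ext_of_Iic _ _ fun t => ?_
    -- A marginal event is a box with all other corners at 1, where the pseudo-inverse is 0; the sum
    -- then has one term and gives back t.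
    have hset : (fun x : Fin (n + 1) → I => x i) ⁻¹' Iic t = Iic (Function.update (1 : Fin (n + 1) → I) i t) := by
      ext x
      simp only [mem_preimage, mem_Iic, Pi.le_def]
      refine ⟨fun hx j => ?_, fun hx => by simpa using hx i⟩
      rcases eq_or_ne j i with rfl | hj
      · simpa using hx
      · simpa [hj] using unitInterval.le_one'
    have h1 : pseudoInverse (genNN n c κ) 1 = 0 := by
      rw [← gen_zero hn hc h, pseudoInverse_gen hn hc h le_rfl, ENNReal.ofReal_zero]
    rw [Measure.map_apply (measurable_pi_apply i) measurableSet_Iic, hset,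
      baseMeasure_sample_Iic hn hc h hvol, Finset.sum_eq_single i, Function.update_self,
      extendTop_pseudoInverse hn hc h, unitInterval.volume_Iic]
    · intro j _ hj
      rw [Function.update_of_ne hj, Pi.one_apply, h1]
    · simp

section

variable (hn : n ≠ 0) (hc : 0 < c) (h : IsRadial n c κ)
  (hvol : ∀ t, 0 ≤ t → volume (solidSimplex n t) = ENNReal.ofReal (c * t ^ n))

theorem isArchimedean_copula : (copula hn hc h hvol).IsArchimedean :=
  ⟨genNN n c κ, isGenerator_genNN hn hc h, fun _ => rfl⟩

theorem measure_copula :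
    (copula hn hc h hvol).measure = (baseMeasure n κ).map (sample n c κ) :=
  ((copula hn hc h hvol).eq_measure (baseMeasure_sample_Iic hn hc h hvol)).symm

theorem measurable_copula : Measurable (copula hn hc h hvol).toFun := by
  have h1 := (strictAnti_extendTop hn hc h).antitone.measurable
  have h2 := measurable_pseudoInverse hn hc h
  exact h1.comp (Finset.measurable_fun_sum _ fun i _ => h2.comp (measurable_pi_apply i))

/-- The pseudo-inverses undo the generator and the coordinates add up to r, so the Kendall
distribution is the law of ψ(r). -/
theorem copula_sample {p : (Fin n → ℝ) × ℝ} (hp : p ∈ simplexDomain n) :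
    copula hn hc h hvol (sample n c κ p) = gen n c κ p.2 := by
  have h0 := mem_simplexDomain_iff.1 hp
  have hsum : ∑ i, pseudoInverse (genNN n c κ) (sample n c κ p i) = ENNReal.ofReal p.2 := by
    rw [← sum_coords p, ENNReal.ofReal_sum_of_nonneg fun i _ => h0 i]
    exact Finset.sum_congr rfl fun i _ => pseudoInverse_gen hn hc h (h0 i)
  have h2 : 0 ≤ p.2 := (sum_coords p).symm ▸ Finset.sum_nonneg fun i _ => h0 i
  change extendTop _ (∑ i, pseudoInverse (genNN n c κ) (sample n c κ p i)) = _
  rw [hsum, extendTop_genNN_ofReal h2]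

/-- The law of the copula under its own measure. -/
theorem map_measure_copula :
    (copula hn hc h hvol).measure.map (copula hn hc h hvol).toFun =
      ((baseMeasure n κ).map Prod.snd).map (gen n c κ) := by
  rw [measure_copula, Measure.map_map (measurable_copula hn hc h hvol)
    h.continuous_sample.measurable, Measure.map_map h.continuous_gen.measurable measurable_snd]
  refine Measure.map_congr ?_
  filter_upwards [ae_mem_simplexDomain] with p hp
  exact copula_sample hn hc h hvol hp

include h in
-- Where all coordinates are positive, an open set inside the domain, the restriction is invisible
-- and Lebesgue ⊗ `κ` has full support.
theorem baseMeasure_ne_zero {O : Set ((Fin n → ℝ) × ℝ)} (hO : IsOpen O)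
    (hne : ∃ p ∈ O, ∀ i, 0 < coords p i) : baseMeasure n κ O ≠ 0 := by
  have := h.finite
  have := h.openPos
  obtain ⟨p, hp, hpos⟩ := hne
  have hopen : IsOpen (O ∩ {p | ∀ i, 0 < coords p i}) := by
    refine hO.inter ?_
    rw [ofPred_forall]
    exact isOpen_iInter_of_finite fun i =>
      isOpen_lt continuous_const ((continuous_apply i).comp continuous_coords)
  have hsub : O ∩ {p | ∀ i, 0 < coords p i} ⊆ O ∩ simplexDomain n := fun q hq =>
    ⟨hq.1, mem_simplexDomain_iff.2 fun i => (hq.2 i).le⟩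
  rw [baseMeasure, Measure.restrict_apply hO.measurableSet]
  exact ((hopen.measure_pos _ ⟨p, hp, hpos⟩).trans_le (measure_mono hsub)).ne'

theorem exists_coords_eq (a : Fin (n + 1) → ℝ) : ∃ p, coords p = a := by
  refine ⟨(Fin.init a, ∑ i, a i), ?_⟩
  rw [coords, Fin.sum_univ_castSucc]
  simp [Fin.init]

theorem isOpenPosMeasure_copula : (copula hn hc h hvol).measure.IsOpenPosMeasure := by
  refine ⟨fun O hO hne => ?_⟩
  rw [measure_copula, Measure.map_apply h.continuous_sample.measurable hO.measurableSet]
  refine baseMeasure_ne_zero h (hO.preimage h.continuous_sample) ?_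
  obtain ⟨u, hu⟩ := hne
  obtain ⟨V, hV, hVO⟩ := isOpen_pi_iff'.1 hO u hu
  choose a ha haV using fun i =>
    exists_gen_mem_of_isOpen hn hc h (hV i).1 ⟨u i, (hV i).2⟩
  obtain ⟨p, rfl⟩ := exists_coords_eq a
  exact ⟨p, hVO fun i _ => haV i, ha⟩

theorem baseMeasure_map_snd_absolutelyContinuous [SFinite κ] :
    (baseMeasure n κ).map Prod.snd ≪ κ :=
  (Measure.restrict_le_self.absolutelyContinuous.map measurable_snd).trans
    Measure.quasiMeasurePreserving_snd.absolutelyContinuous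

theorem baseMeasure_map_snd_compl_Ici : (baseMeasure n κ).map Prod.snd (Ici 0)ᶜ = 0 := by
  rw [Measure.map_apply measurable_snd measurableSet_Ici.compl, measure_eq_zero_iff_ae_notMem]
  filter_upwards [ae_mem_simplexDomain] with p hp hp'
  exact hp' ((Finset.sum_nonneg fun i _ => hp.1 i).trans hp.2)

theorem kendall_properties (C : Copula (n + 1)) (hC : C = copula hn hc h hvol) :
    (∀ t : I, C.measure (C.levelSet t) = 0) ∧ ContinuousOn C.kendallCDF (Icc 0 1) ∧
      StrictMonoOn C.kendallCDF (Icc 0 1) ∧ IsSingularFun C.kendallCDF := by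
  have hfin := h.finite
  have hsing := h.nullSingleton
  have hm : Measurable C.toFun := hC ▸ measurable_copula hn hc h hvol
  have hlaw : C.measure.map C.toFun = ((baseMeasure n κ).map Prod.snd).map (gen n c κ) :=
    hC ▸ map_measure_copula hn hc h hvol
  have hac := baseMeasure_map_snd_absolutelyContinuous (n := n) (κ := κ)
  have h0 : NullSingletonClass ((baseMeasure n κ).map Prod.snd) :=
    ⟨fun x => hac (measure_singleton x)⟩
  have h1 : NullSingletonClass (C.measure.map C.toFun) :=
    hlaw ▸ nullSingletonClass_map_gen hn hc h baseMeasure_map_snd_compl_Ici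
  have h2 : (C.measure.map C.toFun).IsOpenPosMeasure := by
    rw [hlaw]
    refine isOpenPosMeasure_map_gen hn hc h fun O hO hne => ?_
    obtain ⟨a, haO, ha⟩ := hne
    rw [Measure.map_apply measurable_snd hO.measurableSet]
    refine baseMeasure_ne_zero h (hO.preimage continuous_snd) ?_
    obtain ⟨p, hp⟩ := exists_coords_eq fun _ : Fin (n + 1) => a / (n + 1)
    refine ⟨p, ?_, fun i => ?_⟩
    · rw [mem_preimage, ← sum_coords p, hp]
      have : (n + 1 : ℝ) ≠ 0 := by positivity
      simpa [mul_div_cancel₀ _ this] using haO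
    · rw [hp]
      exact div_pos ha (by positivity)
  have h3 : C.measure.map C.toFun ⟂ₘ volume :=
    hlaw ▸ map_gen_mutuallySingular hn hc h baseMeasure_map_snd_compl_Ici
      (h.singular.mono_ac hac .rfl)
  have hP : IsProbabilityMeasure (C.measure.map C.toFun) :=
    Measure.isProbabilityMeasure_map hm.aemeasurable
  refine ⟨fun t => ?_, cdf_properties _ h3 _ fun y => ?_⟩
  · have := measure_singleton (μ := C.measure.map C.toFun) t
    rwa [Measure.map_apply hm (measurableSet_singleton t)] at this
  · exact (map_measureReal_apply hm (measurable_subtype_coe measurableSet_Iic)).symm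

end

end IsRadial

/-! ### The conditional distributions -/

/-- The law of `r - s`, where `r` is distributed according to `κ` conditioned on `[s,∞)`. -/
noncomputable def excessMeasure (κ : Measure ℝ) (s : ℝ) : Measure ℝ :=
  (κ (Ici s))⁻¹ • (κ.restrict (Ici s)).map fun r => r - s

theorem excessMeasure_apply {s : ℝ} {B : Set ℝ} (hB : MeasurableSet B) :
    excessMeasure κ s B = (κ (Ici s))⁻¹ * κ {r | s ≤ r ∧ r - s ∈ B} := by
  have hm : Measurable fun r : ℝ => r - s := by fun_prop
  rw [excessMeasure, Measure.smul_apply, Measure.map_apply hm hB,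
    Measure.restrict_apply (hm hB), smul_eq_mul]
  congr 2
  ext r
  exact and_comm

theorem isProbabilityMeasure_excessMeasure [IsFiniteMeasure κ] [κ.IsOpenPosMeasure] (s : ℝ) :
    IsProbabilityMeasure (excessMeasure κ s) := by
  refine ⟨?_⟩
  have h0 : κ (Ici s) ≠ 0 :=
    ((isOpen_Ioi.measure_pos κ nonempty_Ioi).trans_le (measure_mono Ioi_subset_Ici_self)).ne'
  rw [excessMeasure_apply MeasurableSet.univ]
  simp only [mem_univ, and_true]
  exact ENNReal.inv_mul_cancel h0 (measure_ne_top κ _)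

theorem measurable_excessMeasure [IsFiniteMeasure κ] : Measurable (excessMeasure κ) := by
  refine Measure.measurable_of_measurable_coe _ fun B hB => ?_
  simp_rw [excessMeasure_apply hB]
  have h0 : Antitone fun s : ℝ => κ (Ici s) := fun a b hab => measure_mono (Ici_subset_Ici.2 hab)
  have h1 : Measurable fun s : ℝ => κ (Ici s) := h0.measurable
  have h2 : MeasurableSet {p : ℝ × ℝ | p.1 ≤ p.2 ∧ p.2 - p.1 ∈ B} :=
    (measurableSet_le measurable_fst measurable_snd).inter
      ((measurable_snd.sub measurable_fst) hB)
  exact h1.inv.mul (measurable_measure_prodMk_left h2)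

theorem excessMeasure_compl_Ici (s : ℝ) : excessMeasure κ s (Ici 0)ᶜ = 0 := by
  rw [excessMeasure_apply measurableSet_Ici.compl]
  have : {r | s ≤ r ∧ r - s ∈ (Ici (0 : ℝ))ᶜ} = ∅ :=
    eq_empty_of_forall_notMem fun r hr => hr.2 (sub_nonneg.2 hr.1)
  rw [this, measure_empty, mul_zero]

theorem nullSingletonClass_excessMeasure [NullSingletonClass κ] (s : ℝ) :
    NullSingletonClass (excessMeasure κ s) := by
  refine ⟨fun x => ?_⟩
  rw [excessMeasure_apply (measurableSet_singleton x)]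
  have : {r | s ≤ r ∧ r - s ∈ ({x} : Set ℝ)} ⊆ {x + s} := fun r hr => by
    rw [mem_singleton_iff, ← sub_eq_iff_eq_add]
    exact hr.2
  rw [measure_mono_null this (measure_singleton _), mul_zero]

theorem excessMeasure_ne_zero [IsFiniteMeasure κ] [κ.IsOpenPosMeasure] (s : ℝ) {O : Set ℝ}
    (hO : IsOpen O) (hne : (O ∩ Ioi 0).Nonempty) : excessMeasure κ s O ≠ 0 := by
  obtain ⟨a, haO, ha⟩ := hne
  rw [excessMeasure_apply hO.measurableSet]
  refine mul_ne_zero (ENNReal.inv_ne_zero.2 (measure_ne_top κ _)) ?_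
  have hopen : IsOpen (Ioi s ∩ (fun r => r - s) ⁻¹' O) :=
    isOpen_Ioi.inter (hO.preimage (continuous_id.sub continuous_const))
  have hmem : a + s ∈ Ioi s ∩ (fun r => r - s) ⁻¹' O :=
    ⟨lt_add_of_pos_left s ha, by simpa using haO⟩
  have hsub : Ioi s ∩ (fun r => r - s) ⁻¹' O ⊆ {r | s ≤ r ∧ r - s ∈ O} := fun r hr =>
    ⟨le_of_lt hr.1, hr.2⟩
  exact ((hopen.measure_pos κ ⟨_, hmem⟩).trans_le (measure_mono hsub)).ne'

theorem excessMeasure_mutuallySingular (hκ : κ ⟂ₘ volume) (s : ℝ) :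
    excessMeasure κ s ⟂ₘ volume := by
  have h1 : (κ.restrict (Ici s)).map (fun r => r - s) ⟂ₘ
      (volume : Measure ℝ).map fun r => r - s :=
    (measurableEmbedding_subRight s).mutuallySingular_map (hκ.restrict _)
  rw [(measurePreserving_sub_right volume s).map_eq] at h1
  exact h1.smul _

theorem lintegral_excessMeasure {g : ℝ → ℝ≥0∞} (hg : Measurable g) (s : ℝ) :
    ∫⁻ y, g y ∂excessMeasure κ s = (κ (Ici s))⁻¹ * ∫⁻ r in Ici s, g (r - s) ∂κ := by
  rw [excessMeasure, lintegral_smul_measure, lintegral_map hg (by fun_prop), smul_eq_mul]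

namespace IsRadial

/-- The kernel of the copula generated by `κ`. -/
noncomputable def kernel (hn : n ≠ 0) (hc : 0 < c) (h : IsRadial n c κ) : Kernel (Fin n → I) I where
  -- If some u_i = 0, then `invGen` takes the default value 0; the measure is still a probability,
  -- and such u do not matter for the disintegration.
  toFun u := (excessMeasure κ (∑ i, invGen n c κ (u i))).map (gen n c κ)
  measurable' := by
    have := h.finite
    have h1 := measurable_invGen hn hc h
    exact (Measure.measurable_map _ h.continuous_gen.measurable).comp
      (measurable_excessMeasure.comp
        (Finset.measurable_fun_sum _ fun i _ => h1.comp (measurable_pi_apply i)))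

variable (hn : n ≠ 0) (hc : 0 < c) (h : IsRadial n c κ)
  (hvol : ∀ t, 0 ≤ t → volume (solidSimplex n t) = ENNReal.ofReal (c * t ^ n))

theorem kernel_apply (u : Fin n → I) : kernel hn hc h u =
    (excessMeasure κ (∑ i, invGen n c κ (u i))).map (gen n c κ) := rfl

theorem isMarkovKernel_kernel : IsMarkovKernel (kernel hn hc h) := by
  have := h.finite
  have := h.openPos
  refine ⟨fun u => ?_⟩
  have := isProbabilityMeasure_excessMeasure (κ := κ) (∑ i, invGen n c κ (u i))
  exact Measure.isProbabilityMeasure_map h.continuous_gen.aemeasurable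

theorem nullSingletonClass_kernel (u : Fin n → I) : NullSingletonClass (kernel hn hc h u) := by
  have := h.nullSingleton
  have := nullSingletonClass_excessMeasure (κ := κ) (∑ i, invGen n c κ (u i))
  exact nullSingletonClass_map_gen hn hc h (excessMeasure_compl_Ici _)

theorem isOpenPosMeasure_kernel (u : Fin n → I) : (kernel hn hc h u).IsOpenPosMeasure := by
  have := h.finite
  have := h.openPos
  exact isOpenPosMeasure_map_gen hn hc h fun O hO hne => excessMeasure_ne_zero _ hO hne

theorem kernel_mutuallySingular (u : Fin n → I) : kernel hn hc h u ⟂ₘ volume :=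
  map_gen_mutuallySingular hn hc h (excessMeasure_compl_Ici _)
    (excessMeasure_mutuallySingular h.singular _)

theorem kernel_gen {x : Fin n → ℝ} (hx : 0 ≤ x) : kernel hn hc h (fun i => gen n c κ (x i)) =
    (excessMeasure κ (∑ i, x i)).map (gen n c κ) := by
  rw [kernel_apply]
  congr 2
  exact Finset.sum_congr rfl fun i _ => invGen_gen hn hc h (hx i)

theorem measurable_init_last : Measurable fun u : Fin (n + 1) → I =>
    ((Fin.init u : Fin n → I), u (Fin.last n)) :=
  Copula.measurable_init.prodMk (measurable_pi_apply _)

/-- The disintegration of the copula with respect to the first `n` coordinates. -/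
theorem disintegration : (copula hn hc h hvol).measure.map
      (fun u : Fin (n + 1) → I => ((Fin.init u : Fin n → I), u (Fin.last n))) =
    (copula hn hc h hvol).measure.map Fin.init ⊗ₘ kernel hn hc h := by
  have := h.finite
  have := h.openPos
  have := isMarkovKernel_kernel hn hc h
  have hlast : Measurable fun p : (Fin n → ℝ) × ℝ => gen n c κ (p.2 - ∑ i, p.1 i) := by
    refine h.continuous_gen.measurable.comp (measurable_snd.sub ?_)
    exact Finset.measurable_fun_sum _ fun i _ => (measurable_pi_apply i).comp measurable_fst
  have hfst : Measurable fun p : (Fin n → ℝ) × ℝ => fun i => gen n c κ (p.1 i) :=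
    measurable_pi_lambda _ fun i =>
      h.continuous_gen.measurable.comp ((measurable_pi_apply i).comp measurable_fst)
  have hinit : (copula hn hc h hvol).measure.map Fin.init =
      (baseMeasure n κ).map fun p => fun i => gen n c κ (p.1 i) := by
    rw [measure_copula, Measure.map_map Copula.measurable_init h.continuous_sample.measurable]
    congr 1
    ext p i
    simp [Fin.init, sample, coords]
  have hjoint : (copula hn hc h hvol).measure.map
      (fun u : Fin (n + 1) → I => ((Fin.init u : Fin n → I), u (Fin.last n))) =
      (baseMeasure n κ).map fun p => ((fun i => gen n c κ (p.1 i)),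
        gen n c κ (p.2 - ∑ i, p.1 i)) := by
    rw [measure_copula, Measure.map_map measurable_init_last h.continuous_sample.measurable]
    congr 1
    ext p
    · simp [Fin.init, sample, coords]
    · simp [sample, coords]
  refine Measure.ext_of_lintegral _ fun f hf => ?_
  have hinner : Measurable fun u => ∫⁻ v, f (u, v) ∂kernel hn hc h u :=
    hf.lintegral_kernel_prod_right'
  rw [Measure.lintegral_compProd hf, hinit, hjoint,
    lintegral_map hf (hfst.prodMk hlast),
    lintegral_map hinner hfst]
  refine (lintegral_baseMeasure (hf.comp (hfst.prodMk hlast))).trans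
    (Eq.trans ?_ (lintegral_baseMeasure (hinner.comp hfst)).symm)
  refine setLIntegral_congr_fun (s := {x : Fin n → ℝ | 0 ≤ x}) measurableSet_Ici fun x hx => ?_
  have h0 : κ (Ici (∑ i, x i)) ≠ 0 :=
    ((isOpen_Ioi.measure_pos κ nonempty_Ioi).trans_le (measure_mono Ioi_subset_Ici_self)).ne'
  have hfx : Measurable fun v => f ((fun i => gen n c κ (x i)), v) :=
    hf.comp measurable_prodMk_left
  simp only [Function.comp_apply]
  rw [lintegral_const, Measure.restrict_apply_univ, kernel_gen hn hc h hx,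
    lintegral_map hfx h.continuous_gen.measurable]
  have hex := lintegral_excessMeasure (κ := κ) (hfx.comp h.continuous_gen.measurable) (∑ i, x i)
  simp only [Function.comp_apply] at hex
  -- The first n coordinates have density κ[∑ x_i, ∞) at x, which cancels the normalizing constant
  -- of the conditional law.
  rw [hex, mul_comm, ← mul_assoc, ENNReal.mul_inv_cancel h0 (measure_ne_top κ _), one_mul]

theorem markovKernel_ae_eq (C : Copula (n + 1)) (hC : C = copula hn hc h hvol) :
    ∀ᵐ u ∂C.initMarginal.measure, C.markovKernel u = kernel hn hc h u := by
  have := isMarkovKernel_kernel hn hc h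
  rw [Copula.measure_initMarginal]
  refine condDistrib_ae_eq_of_measure_eq_compProd _ (measurable_pi_apply _).aemeasurable ?_
  rw [hC]
  exact disintegration hn hc h hvol

/-- Both measures are disintegrated along the first n coordinates. Their kernels are mutually
singular at every point, which suffices whatever the first marginals are. -/
theorem copula_mutuallySingular : (copula hn hc h hvol).measure ⟂ₘ volume := by
  have := isMarkovKernel_kernel hn hc h
  have hvp : (volume : Measure (Fin (n + 1) → I)).map
      (fun u => ((Fin.init u : Fin n → I), u (Fin.last n))) = volume ⊗ₘ Kernel.const _ volume := by
    rw [Measure.compProd_const]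
    have h1 := (Measure.measurePreserving_swap (μ := (volume : Measure I))
      (ν := (volume : Measure (Fin n → I)))).comp
      (volume_preserving_piFinSuccAbove (fun _ : Fin (n + 1) => I) (Fin.last n))
    rw [← h1.map_eq]
    congr 1
    ext u i
    · simp [Fin.init]
    · simp
  have hs : (copula hn hc h hvol).measure.map Fin.init ⊗ₘ kernel hn hc h ⟂ₘ
      (volume : Measure (Fin n → I)) ⊗ₘ Kernel.const _ (volume : Measure I) :=
    Measure.MutuallySingular.compProd_of_right _ _
      (ae_of_all _ fun u => kernel_mutuallySingular hn hc h u)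
  rw [← disintegration, ← hvp] at hs
  obtain ⟨s, hs, h1, h2⟩ := hs
  rw [Measure.map_apply measurable_init_last hs] at h1
  rw [Measure.map_apply measurable_init_last hs.compl] at h2
  exact ⟨_, measurable_init_last hs, h1, h2⟩

end IsRadial

end ArchCopula

/-- The dimension is `d = n + 1 ≥ 3`. -/
theorem mainTheorem7 (n : ℕ) (hn : 3 ≤ n + 1) :
    ∃ C : ArchCopula.Copula (n + 1), C.IsArchimedean ∧
      -- (1) singular continuous with full support
      (C.SingularContinuous ∧ C.measure.support = Set.univ) ∧
      -- (2) almost all conditional distribution functions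
      (∀ᵐ x ∂C.initMarginal.measure,
        ContinuousOn (C.condCDF x) (Set.Icc 0 1) ∧
        StrictMonoOn (C.condCDF x) (Set.Icc 0 1) ∧
        ArchCopula.IsSingularFun (C.condCDF x)) ∧
      -- (3) level sets
      (∀ t : unitInterval, C.measure (C.levelSet t) = 0) ∧
      -- (4) the Kendall distribution function
      (ContinuousOn C.kendallCDF (Set.Icc 0 1) ∧
        StrictMonoOn C.kendallCDF (Set.Icc 0 1) ∧
        ArchCopula.IsSingularFun C.kendallCDF) := by
  have hn0 : n ≠ 0 := by omega
  obtain ⟨c, hc, hvol⟩ := ArchCopula.exists_volume_solidSimplex n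
  obtain ⟨κ, h⟩ := ArchCopula.exists_isRadial hn0 hc
  obtain ⟨C, hC⟩ : ∃ C, C = h.copula hn0 hc hvol := ⟨_, rfl⟩
  have hK := h.markovKernel_ae_eq hn0 hc hvol C hC
  have hopen : C.measure.IsOpenPosMeasure := hC ▸ h.isOpenPosMeasure_copula hn0 hc hvol
  refine ⟨C, hC ▸ h.isArchimedean_copula hn0 hc hvol, ⟨⟨⟨?_, fun x => ?_⟩, ?_⟩, ?_⟩, ?_,
    h.kendall_properties hn0 hc hvol C hC⟩
  · exact hC ▸ h.copula_mutuallySingular hn0 hc hvol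
  -- A point lies in a hyperplane of fixed first coordinate, which is null because that marginal is
  -- uniform.
  · have h0 : C.measure.map (fun u => u 0) {x 0} = 0 := by
      rw [C.map_measure, measure_singleton]
    rw [Measure.map_apply (measurable_pi_apply 0) (measurableSet_singleton _)] at h0
    exact measure_mono_null (by rintro _ rfl; rfl) h0
  · filter_upwards [hK] with u hu
    have := h.nullSingletonClass_kernel hn0 hc u
    rw [hu]
    exact ⟨h.kernel_mutuallySingular hn0 hc u, fun x => measure_singleton x⟩
  · exact Measure.support_eq_univ
  · filter_upwards [hK] with u hu
    have h1 := h.nullSingletonClass_kernel hn0 hc u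
    have h2 := h.isOpenPosMeasure_kernel hn0 hc u
    have h3 := h.isMarkovKernel_kernel hn0 hc
    refine ArchCopula.cdf_properties _ (h.kernel_mutuallySingular hn0 hc u) _ fun y => ?_
    rw [ArchCopula.Copula.condCDF, hu]
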